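/- For $b>0$ let $B(b)=\{z\in\mathbb{C} : |\operatorname{Im} z|<b\}$, and let $B(b)/\mathbb{Z}\subset\mathbb{C}/\mathbb{Z}$ be its quotient by the translation $z\mapsto z+1$. Equip $\mathbb{C}/\mathbb{Z}$ with its Euclidean quotient metric $d$, i.e. $d(p(z),p(w))=\min_{n\in\mathbb{Z}}|z-w-n|$, where $p:\mathbb{C}\to\mathbb{C}/\mathbb{Z}$ is the projection. Identify both $\pi_1(B(b)/\mathbb{Z},0)$ and $\pi_1(\mathbb{C}/\mathbb{Z},0)$ with $\mathbb{Z}$ so that the class of the loop $t\mapsto p(t)$, $0\le t\le 1$, is $1$. Theorem. For every $\varepsilon>0$ there exists $c>0$, depending only on $\varepsilon$, such that for every $b>c$ and every conformal embedding (injective holomorphic map) $\varphi:B(b)/\mathbb{Z}\to\mathbb{C}/\mathbb{Z}$ with $\varphi(0)=0$ and $\varphi_*(1)=1$ on fundamental groups, one has $d(\varphi(q),q)<\varepsilon$ for all $q\in B(b-c)/\mathbb{Z}$. -/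

import Mathlib

open Topology

noncomputable section

/-- The bi-infinite cylinder `ℂ / ℤ`. It carries Mathlib's quotient norm, so that the distance
between two points is the minimum of `|z - w|` over all lifts `z`, `w` to `ℂ`: this is the
Euclidean (flat) distance of the cylinder. -/
abbrev Cyl : Type := ℂ ⧸ AddSubgroup.zmultiples (1 : ℂ)

/-- The covering projection `ℂ → ℂ / ℤ`. -/
def cylProj (z : ℂ) : Cyl := (z : ℂ ⧸ AddSubgroup.zmultiples (1 : ℂ))

/-- The horizontal strip `B(b)` of height `2 b` centred on the real line. -/
def strip (b : ℝ) : Set ℂ := {z | |z.im| < b}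

/-- The straight cylinder `B(b) / ℤ`, as a subset of `ℂ / ℤ`. -/
def stripMod (b : ℝ) : Set Cyl := cylProj '' strip b

theorem continuous_cylProj : Continuous cylProj := continuous_quotient_mk'

theorem cylProj_ofReal_mem {b : ℝ} (hb : 0 < b) (t : ℝ) : cylProj (t : ℂ) ∈ stripMod b :=
  ⟨t, by simpa [strip] using hb, rfl⟩

theorem cylProj_one : cylProj ((1 : ℝ) : ℂ) = cylProj ((0 : ℝ) : ℂ) := by
  refine QuotientAddGroup.eq.2 ?_
  simp

/-- The point of `B(b) / ℤ` represented by the real number `t`. -/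
def stripModPt {b : ℝ} (hb : 0 < b) (t : ℝ) : stripMod b := ⟨cylProj (t : ℂ), cylProj_ofReal_mem hb t⟩

/-- The loop `t ↦ t mod ℤ`, `0 ≤ t ≤ 1`, in `ℂ / ℤ`. -/
def cylLoop : Path (cylProj ((0 : ℝ) : ℂ)) (cylProj ((0 : ℝ) : ℂ)) where
  toFun t := cylProj ((t : ℝ) : ℂ)
  continuous_toFun := continuous_cylProj.comp (by fun_prop)
  source' := by simp
  target' := by simpa using cylProj_one

/-- The loop `t ↦ t mod ℤ`, `0 ≤ t ≤ 1`, in `B(b) / ℤ`. -/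
def stripLoop {b : ℝ} (hb : 0 < b) : Path (stripModPt hb 0) (stripModPt hb 0) where
  toFun t := stripModPt hb (t : ℝ)
  continuous_toFun :=
    Continuous.subtype_mk (continuous_cylProj.comp (by fun_prop)) _
  source' := by simp
  target' := Subtype.ext (by simpa [stripModPt] using cylProj_one)

/-- The generator `1` of `π₁(ℂ / ℤ, 0) = ℤ`. -/
def cylGen : FundamentalGroup Cyl (cylProj ((0 : ℝ) : ℂ)) :=
  FundamentalGroup.fromPath (Path.Homotopic.Quotient.mk cylLoop)

/-- The generator `1` of `π₁(B(b) / ℤ, 0) = ℤ`. -/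
def stripGen {b : ℝ} (hb : 0 < b) : FundamentalGroup (stripMod b) (stripModPt hb 0) :=
  FundamentalGroup.fromPath (Path.Homotopic.Quotient.mk (stripLoop hb))

/-- Holomorphy of a map from the open subset `U` of `ℂ / ℤ` to `ℂ / ℤ`. The charts of the Riemann
surface `ℂ / ℤ` are the local inverses of the projection `ℂ → ℂ / ℤ`; so `φ` is holomorphic iff
near every point of the preimage of `U` it is given by a holomorphic function `g` of the coordinate
`z`, that is `φ (z mod ℤ) = g z mod ℤ`. -/
def IsHolomorphicOnCyl {U : Set Cyl} (φ : U → Cyl) : Prop :=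
  ∀ z₀ : ℂ, cylProj z₀ ∈ U → ∃ g : ℂ → ℂ, AnalyticAt ℂ g z₀ ∧
    ∀ᶠ z in 𝓝 z₀, ∀ hz : cylProj z ∈ U, φ ⟨cylProj z, hz⟩ = cylProj (g z)

/-- A conformal embedding of an open subset of `ℂ / ℤ` in `ℂ / ℤ`: an injective holomorphic map.
(Such a map is automatically a homeomorphism onto its open image, with holomorphic inverse.) -/
structure IsConformalEmbedding {U : Set Cyl} (φ : U → Cyl) : Prop where
  holomorphic : IsHolomorphicOnCyl φ
  injective : Function.Injective φ

end

/-! Lift `φ` to a holomorphic `f` on the strip with `f 0 = 0`. The condition on fundamental groups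
gives `f (z + 1) = f z + 1`, so `f z - z` is `1`-periodic. On a disc of radius `1/4`, injectivity of
`φ` forbids two values of `f` differing by `1`. By Bloch's theorem the image of a disc contains a
ball of radius proportional to `‖deriv f‖` at the centre, so `norm_deriv_lift_le` bounds `deriv f`
at depth `1` by an absolute constant. A periodic function with bounded derivative stays within a
bounded distance of its mean. Shifting the contour makes its nonzero Fourier coefficients decay
exponentially with the distance `s` to the edge, so `norm_sub_le_of_norm_deriv_le` makes `f z - z`
nearly constant. It vanishes at `0`, and no bound depends on `b`. -/

/-! ### Bloch's theorem and a derivative bound. -/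

open Complex Metric Set in
/-- **Bloch's theorem**, with a non-optimal constant. -/
theorem exists_ball_subset_image_of_differentiableOn {f : ℂ → ℂ} {U : Set ℂ} (hU : IsOpen U)
    (hf : DifferentiableOn ℂ f U) {z₀ : ℂ} {r : ℝ} (hr : 0 < r) (hsub : closedBall z₀ r ⊆ U) :
    ∃ a ∈ closedBall z₀ r,
      ball (f a) (r * ‖deriv f z₀‖ / 48) ⊆ f '' closedBall z₀ r := by
  have hz₀ : z₀ ∈ closedBall z₀ r := mem_closedBall_self hr.le
  rcases eq_or_ne (deriv f z₀) 0 with h0 | h0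
  · exact ⟨z₀, hz₀, by simp [h0]⟩
  have hd : DifferentiableOn ℂ (deriv f) U := hf.deriv hU
  -- Maximising `‖f'‖` weighted by the distance to the boundary ensures that `‖f'‖` at most doubles
  -- on the disc about `a` of half the remaining radius.
  obtain ⟨a, ha, hmax⟩ := (isCompact_closedBall z₀ r).exists_isMaxOn ⟨z₀, hz₀⟩
    (f := fun z ↦ ‖deriv f z‖ * (r - dist z z₀))
    ((hd.continuousOn.mono hsub).norm.mul (by fun_prop))
  have hd0 : 0 < ‖deriv f z₀‖ := norm_pos_iff.2 h0
  have ha0 : ‖deriv f z₀‖ * r ≤ ‖deriv f a‖ * (r - dist a z₀) := by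
    simpa using isMaxOn_iff.1 hmax z₀ hz₀
  have hprod : 0 < ‖deriv f a‖ * (r - dist a z₀) := (by positivity : (0 : ℝ) < _).trans_le ha0
  have hA : 0 < ‖deriv f a‖ := pos_of_mul_pos_left hprod (sub_nonneg.2 ha)
  set t : ℝ := (r - dist a z₀) / 2 with ht
  have ht0 : 0 < t := by
    have := pos_of_mul_pos_right hprod hA.le
    positivity
  have hsub' : closedBall a t ⊆ closedBall z₀ r :=
    closedBall_subset_closedBall' (by linarith [ht, ht0])
  have hbd : ∀ z ∈ closedBall a t, ‖deriv f z‖ ≤ 2 * ‖deriv f a‖ := by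
    intro z hz
    have h1 : ‖deriv f z‖ * (r - dist z z₀) ≤ ‖deriv f a‖ * (2 * t) := by
      have := isMaxOn_iff.1 hmax z (hsub' hz)
      simpa [ht, mul_div_cancel₀] using this
    have h2 : t ≤ r - dist z z₀ := by
      have := dist_triangle z a z₀
      have := mem_closedBall.1 hz
      linarith
    have h3 := mul_le_mul_of_nonneg_left h2 (norm_nonneg (deriv f z))
    have h4 : ‖deriv f z‖ * t ≤ (2 * ‖deriv f a‖) * t := by linarith
    exact le_of_mul_le_mul_right h4 ht0
  -- Schwarz lemma: `f'` stays within `3 * ‖f' a‖` of `f' a` on radius `t`, hence within a sixth of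
  -- that on radius `t / 6`.
  have hlip : ∀ z ∈ closedBall a (t / 6), ‖deriv f z - deriv f a‖ ≤ ‖deriv f a‖ / 2 := by
    intro z hz
    have hz' : dist z a ≤ t / 6 := hz
    have := dist_le_div_mul_dist_of_mapsTo_ball (f := deriv f) (c := a) (R₁ := t)
      (R₂ := 3 * ‖deriv f a‖) (z := z)
      (hd.mono ((ball_subset_closedBall.trans hsub').trans hsub)) (fun w hw ↦ by
        rw [mem_closedBall, dist_eq_norm]
        have := hbd w (ball_subset_closedBall hw)
        linarith [norm_sub_le (deriv f w) (deriv f a)])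
      (by rw [mem_ball]; linarith)
    rw [dist_eq_norm] at this
    calc _ ≤ _ := this
      _ ≤ 3 * ‖deriv f a‖ / t * (t / 6) := by gcongr
      _ = ‖deriv f a‖ / 2 := by field_simp; norm_num
  have hsub6 : closedBall a (t / 6) ⊆ closedBall z₀ r :=
    (closedBall_subset_closedBall (by linarith)).trans hsub'
  have hat : a ∈ closedBall a (t / 6) := mem_closedBall_self (by positivity)
  have hlow : ∀ z ∈ closedBall a (t / 6), ‖deriv f a‖ / 2 * ‖z - a‖ ≤ ‖f z - f a‖ := by
    intro z hz
    have := (convex_closedBall a (t / 6)).norm_image_sub_le_of_norm_hasDerivWithin_le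
      (f := fun w ↦ f w - deriv f a * w) (f' := fun w ↦ deriv f w - deriv f a)
      (C := ‖deriv f a‖ / 2) (x := a) (y := z)
      (fun w hw ↦ by
        have h1 := (hf.differentiableAt (hU.mem_nhds (hsub (hsub6 hw)))).hasDerivAt
        have h2 := h1.sub ((hasDerivAt_id w).const_mul (deriv f a))
        rw [mul_one] at h2
        exact h2.hasDerivWithinAt)
      hlip hat hz
    have h2 : deriv f a * (z - a) =
        (f z - f a) - ((f z - deriv f a * z) - (f a - deriv f a * a)) := by ring
    have h3 := norm_sub_le (f z - f a) ((f z - deriv f a * z) - (f a - deriv f a * a))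
    rw [← h2, norm_mul] at h3
    linarith
  refine ⟨a, ha, ?_⟩
  -- The ball obtained has half the radius `‖f' a‖ / 2 * (t / 6)`, that is `‖f' a‖ * (2 * t) / 48`;
  -- maximality of `a` then gives the constant 48.
  have hball := DiffContOnCl.ball_subset_image_closedBall (f := f) (z₀ := a) (r := t / 6)
    (ε := ‖deriv f a‖ / 2 * (t / 6))
    ((hf.mono (hsub6.trans hsub)).diffContOnCl_ball Subset.rfl) (by positivity)
    (fun z hz ↦ by
      have h := hlow z (sphere_subset_closedBall hz)
      rwa [mem_sphere_iff_norm.1 hz] at h)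
    (by
      have h1 : ∀ᶠ z in 𝓝[≠] a, f z ≠ f a := by
        filter_upwards [self_mem_nhdsWithin,
          mem_nhdsWithin_of_mem_nhds (closedBall_mem_nhds a (by positivity : 0 < t / 6))]
          with z hz hz' heq
        have h := hlow z hz'
        rw [heq, sub_self, norm_zero] at h
        have : 0 < ‖z - a‖ := norm_pos_iff.2 (sub_ne_zero.2 hz)
        nlinarith
      exact h1.frequently.filter_mono nhdsWithin_le_nhds)
  refine (ball_subset_ball ?_).trans (hball.trans (image_mono hsub6))
  have : ‖deriv f a‖ * (2 * t) = ‖deriv f a‖ * (r - dist a z₀) := by rw [ht]; ring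
  linarith

open Metric in
/-- If no two values of a holomorphic function on a disc differ by `1`, its derivative at the
centre is bounded in terms of the radius only. -/
theorem mul_norm_deriv_le_of_forall_ne_add_one {f : ℂ → ℂ} {U : Set ℂ} (hU : IsOpen U)
    (hf : DifferentiableOn ℂ f U) {z₀ : ℂ} {r : ℝ} (hr : 0 < r) (hsub : closedBall z₀ r ⊆ U)
    (hne : ∀ z ∈ closedBall z₀ r, ∀ w ∈ closedBall z₀ r, f z ≠ f w + 1) :
    r * ‖deriv f z₀‖ ≤ 48 := by
  obtain ⟨a, ha, hball⟩ := exists_ball_subset_image_of_differentiableOn hU hf hr hsub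
  by_contra! h
  obtain ⟨z, hz, hza⟩ := hball (show f a + 1 ∈ ball (f a) _ by
    rw [mem_ball, dist_eq_norm]; simp; linarith)
  exact hne z hz a ha hza

/-! ### Periodic holomorphic functions on a strip. -/

theorem mem_strip {b : ℝ} {z : ℂ} : z ∈ strip b ↔ |z.im| < b := Iff.rfl

theorem isOpen_strip (b : ℝ) : IsOpen (strip b) :=
  isOpen_lt (by fun_prop) continuous_const

theorem add_one_mem_strip {b : ℝ} {z : ℂ} : z + 1 ∈ strip b ↔ z ∈ strip b := by
  simp [mem_strip]

theorem convex_strip (b : ℝ) : Convex ℝ (strip b) := by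
  have : strip b = Complex.imLm ⁻¹' Set.Ioo (-b) b := by
    ext z; simp [mem_strip, abs_lt]
  rw [this]
  exact (convex_Ioo _ _).linear_preimage _

open Complex intervalIntegral in
/-- The integral of a `1`-periodic holomorphic function over a horizontal period does not depend on
the height. -/
theorem integral_horizontal_eq {g : ℂ → ℂ} {b : ℝ} (hg : DifferentiableOn ℂ g (strip b))
    (hper : ∀ z ∈ strip b, g (z + 1) = g z) {y y' : ℝ} (hy : |y| < b) (hy' : |y'| < b) :
    ∫ x in (0 : ℝ)..1, g (x + y * I) = ∫ x in (0 : ℝ)..1, g (x + y' * I) := by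
  have hsub : ∀ s ∈ Set.uIcc y y', |s| < b := by
    intro s hs
    have := (convex_Ioo (-b) b).ordConnected.uIcc_subset (abs_lt.1 hy) (abs_lt.1 hy') hs
    exact abs_lt.2 this
  have h := integral_boundary_rect_eq_zero_of_differentiableOn g (y * I) (1 + y' * I)
    (hg.mono fun z hz ↦ by
      have := hz.2
      simp at this
      exact hsub _ this)
  have hv : ∫ s in y..y', g (1 + s * I) = ∫ s in y..y', g (s * I) := by
    refine integral_congr fun s hs ↦ ?_
    have := hper (s * I) (by simpa [mem_strip] using hsub s hs)
    simpa [add_comm] using this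
  simp [hv] at h
  exact sub_eq_zero.1 h

open Complex in
theorem periodic_horizontal {g : ℂ → ℂ} {b : ℝ} (hper : ∀ z ∈ strip b, g (z + 1) = g z)
    {y : ℝ} (hy : |y| < b) : Function.Periodic (fun x : ℝ ↦ g (x + y * I)) 1 := by
  intro x
  have := hper (x + y * I) (by simpa [mem_strip] using hy)
  simp only [ofReal_add, ofReal_one, ← this]
  congr 1; ring

open Complex in
theorem continuous_horizontal {g : ℂ → ℂ} {b : ℝ} (hg : ContinuousOn g (strip b))
    {y : ℝ} (hy : |y| < b) : Continuous (fun x : ℝ ↦ g (x + y * I)) :=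
  hg.comp_continuous (by fun_prop) fun x ↦ by simpa [mem_strip] using hy

open Complex intervalIntegral in
/-- Fourier coefficients on horizontal lines of a bounded `1`-periodic holomorphic function on a
strip decay exponentially, at a rate given by the distance to the boundary. -/
theorem norm_integral_exp_mul_le {g : ℂ → ℂ} {b : ℝ} (hg : DifferentiableOn ℂ g (strip b))
    (hper : ∀ z ∈ strip b, g (z + 1) = g z) {d K : ℝ} (hd : 0 ≤ d) (hdb : d < b)
    (hK : ∀ z : ℂ, |z.im| ≤ d → ‖g z‖ ≤ K) {s y : ℝ} (hy : |y| ≤ d - s) (hs : 0 ≤ s) (n : ℤ) :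
    ‖∫ x in (0 : ℝ)..1, exp (-(2 * Real.pi * I * n * x)) * g (x + y * I)‖ ≤
      K * Real.exp (-(2 * Real.pi * s)) ^ n.natAbs := by
  set G : ℂ → ℂ := fun z ↦ exp (-(2 * Real.pi * I * n * z)) * g z with hG
  have hGd : DifferentiableOn ℂ G (strip b) := by
    refine DifferentiableOn.mul (Differentiable.differentiableOn ?_) hg
    fun_prop
  have hGper : ∀ z ∈ strip b, G (z + 1) = G z := by
    intro z hz
    simp only [hG, hper z hz]
    congr 1
    rw [exp_eq_exp_iff_exists_int]
    exact ⟨-n, by push_cast; ring⟩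
  have hGI : ∀ t : ℝ, ∫ x in (0 : ℝ)..1, G (x + t * I) =
      Real.exp (2 * Real.pi * n * t) *
        ∫ x in (0 : ℝ)..1, exp (-(2 * Real.pi * I * n * x)) * g (x + t * I) := by
    intro t
    rw [← integral_const_mul]
    refine integral_congr fun x _ ↦ ?_
    simp only [hG]
    rw [← mul_assoc]
    congr 1
    rw [ofReal_exp, ← Complex.exp_add]
    congr 1
    push_cast
    linear_combination (-(2 * (Real.pi : ℂ) * n * t)) * I_sq
  have hbound : ∀ t : ℝ, |t| ≤ d →
      ‖∫ x in (0 : ℝ)..1, exp (-(2 * Real.pi * I * n * x)) * g (x + t * I)‖ ≤ K := by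
    intro t ht
    have := norm_integral_le_of_norm_le_const (a := (0 : ℝ)) (b := 1) (C := K)
      (f := fun x : ℝ ↦ exp (-(2 * Real.pi * I * n * x)) * g (x + t * I)) (fun x _ ↦ by
        have h1 : ‖exp (-(2 * Real.pi * I * n * x))‖ = 1 := by
          rw [norm_exp]; simp
        rw [norm_mul, h1, one_mul]
        exact hK _ (by simpa using ht))
    simpa using this
  have key : ∀ t : ℝ, |t| ≤ d → (n : ℝ) * (t - y) ≤ -(s * |(n : ℝ)|) →
      ‖∫ x in (0 : ℝ)..1, exp (-(2 * Real.pi * I * n * x)) * g (x + y * I)‖ ≤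
        K * Real.exp (-(2 * Real.pi * s)) ^ n.natAbs := by
    intro t ht htn
    have h := integral_horizontal_eq hGd hGper (y := y) (y' := t)
      (by linarith) (by linarith)
    rw [hGI, hGI] at h
    have h2 := congrArg norm h
    rw [norm_mul, norm_mul, norm_real, norm_real, Real.norm_of_nonneg (Real.exp_pos _).le,
      Real.norm_of_nonneg (Real.exp_pos _).le] at h2
    have h3 : ‖∫ x in (0 : ℝ)..1, exp (-(2 * Real.pi * I * n * x)) * g (x + y * I)‖ =
        Real.exp (2 * Real.pi * (n * (t - y))) *
        ‖∫ x in (0 : ℝ)..1, exp (-(2 * Real.pi * I * n * x)) * g (x + t * I)‖ := by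
      apply mul_left_cancel₀ (Real.exp_pos (2 * Real.pi * n * y)).ne'
      rw [h2, ← mul_assoc, ← Real.exp_add]
      congr 2; ring
    rw [h3, mul_comm K, ← Real.exp_nat_mul]
    refine mul_le_mul (Real.exp_le_exp.2 ?_) (hbound t ht) (norm_nonneg _) (Real.exp_pos _).le
    have hn : ((n.natAbs : ℕ) : ℝ) = |(n : ℝ)| := by
      rw [Nat.cast_natAbs, Int.cast_abs]
    rw [hn]
    have := mul_le_mul_of_nonneg_left htn (by positivity : (0 : ℝ) ≤ 2 * Real.pi)
    linarith
  obtain ⟨hy1, hy2⟩ := abs_le.1 hy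
  -- Shift the contour to the edge where the exponential factor is small: the lower one for `n ≥ 0`,
  -- the upper one for `n ≤ 0`.
  rcases le_total (0 : ℝ) n with hn | hn
  · refine key (-d) (by rw [abs_neg, abs_of_nonneg hd]) ?_
    rw [abs_of_nonneg hn]
    nlinarith
  · refine key d (by rw [abs_of_nonneg hd]) ?_
    rw [abs_of_nonpos hn]
    nlinarith

theorem hasSum_ite_pow_natAbs {q : ℝ} (h0 : 0 ≤ q) (h1 : q < 1) :
    HasSum (fun n : ℤ ↦ if n = 0 then 0 else q ^ n.natAbs) (2 * (q / (1 - q))) := by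
  have hq : HasSum (fun n : ℕ ↦ q ^ (n + 1)) (q / (1 - q)) := by
    simpa [pow_succ', div_eq_mul_inv] using (hasSum_geometric_of_lt_one h0 h1).mul_left q
  have := HasSum.of_add_one_of_neg_add_one (f := fun n : ℤ ↦ if n = 0 then 0 else q ^ n.natAbs)
    (m := q / (1 - q)) (m' := q / (1 - q))
    (by convert! hq using 2)
    (by convert! hq using 2)
  simpa [two_mul] using this

open Complex intervalIntegral in
/-- A `1`-periodic holomorphic function on a strip that is bounded and has zero mean is
exponentially small far from the boundary. -/
theorem norm_le_of_integral_eq_zero {g : ℂ → ℂ} {b : ℝ} (hg : DifferentiableOn ℂ g (strip b))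
    (hper : ∀ z ∈ strip b, g (z + 1) = g z) {d K : ℝ} (hd : 0 ≤ d) (hdb : d < b)
    (hK : ∀ z : ℂ, |z.im| ≤ d → ‖g z‖ ≤ K) (hint : ∫ x in (0 : ℝ)..1, g x = 0)
    {s : ℝ} (hs : 0 < s) {z : ℂ} (hz : |z.im| ≤ d - s) :
    ‖g z‖ ≤ K * (2 * (Real.exp (-(2 * Real.pi * s)) / (1 - Real.exp (-(2 * Real.pi * s))))) := by
  set q := Real.exp (-(2 * Real.pi * s)) with hq
  have hq1 : q < 1 := by
    rw [hq, Real.exp_lt_one_iff, neg_lt_zero]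
    positivity
  have hzb : |z.im| < b := by linarith
  have : Fact ((0 : ℝ) < 1) := ⟨one_pos⟩
  have hP := periodic_horizontal hper hzb
  let F : C(AddCircle (1 : ℝ), ℂ) := ⟨hP.lift,
    continuous_coinduced_dom.2 (continuous_horizontal hg.continuousOn hzb)⟩
  have hFx : ∀ x : ℝ, F (x : AddCircle (1 : ℝ)) = g (x + z.im * I) := fun x ↦ rfl
  have hcoeff : ∀ n : ℤ, fourierCoeff F n =
      ∫ x in (0 : ℝ)..1, exp (-(2 * Real.pi * I * n * x)) * g (x + z.im * I) := by
    intro n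
    rw [fourierCoeff_eq_intervalIntegral F n 0]
    simp only [div_one, one_smul, zero_add]
    refine integral_congr fun x _ ↦ ?_
    simp only [hFx, smul_eq_mul, fourier_coe_apply]
    congr 2
    push_cast; ring
  have hle : ∀ n : ℤ, ‖fourierCoeff F n‖ ≤ K * (if n = 0 then 0 else q ^ n.natAbs) := by
    intro n
    split_ifs with hn
    · rw [hcoeff, hn]
      -- The zeroth coefficient is the mean, which is the same at every height.
      have h0 := integral_horizontal_eq hg hper hzb (y' := 0) (by simp; linarith)
      simp only [ofReal_zero, zero_mul, add_zero, hint] at h0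
      simp [h0]
    · rw [hcoeff]
      exact norm_integral_exp_mul_le hg hper hd hdb hK hz hs.le n
  have hsum := (hasSum_ite_pow_natAbs (Real.exp_pos _).le hq1).mul_left K
  have hF := has_pointwise_sum_fourier_series_of_summable
    (Summable.of_norm_bounded hsum.summable hle) ((z.re : ℝ) : AddCircle (1 : ℝ))
  rw [hFx, re_add_im] at hF
  rw [← hF.tsum_eq]
  refine tsum_of_norm_bounded hsum fun n ↦ ?_
  rw [norm_smul, fourier_apply, Circle.norm_coe, mul_one]
  exact hle n

open Complex intervalIntegral in
/-- A `1`-periodic holomorphic function on a strip with bounded derivative is exponentially close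
to a constant far from the boundary. -/
theorem norm_sub_le_of_norm_deriv_le {g : ℂ → ℂ} {b : ℝ} (hg : DifferentiableOn ℂ g (strip b))
    (hper : ∀ z ∈ strip b, g (z + 1) = g z) {d K : ℝ} (hd : 0 ≤ d) (hdb : d < b)
    (hK : ∀ z : ℂ, |z.im| ≤ d → ‖deriv g z‖ ≤ K)
    {s : ℝ} (hs : 0 < s) {z w : ℂ} (hz : |z.im| ≤ d - s) (hw : |w.im| ≤ d - s) :
    ‖g z - g w‖ ≤
      4 * K * (Real.exp (-(2 * Real.pi * s)) / (1 - Real.exp (-(2 * Real.pi * s)))) := by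
  have hb0 : 0 < b := by linarith
  set m := ∫ x in (0 : ℝ)..1, g x with hm
  have hcont : ∀ {y : ℝ}, |y| < b → IntervalIntegrable (fun x : ℝ ↦ g (x + y * I))
      MeasureTheory.volume 0 1 := fun hy ↦
    (continuous_horizontal hg.continuousOn hy).intervalIntegrable _ _
  have hcont0 : IntervalIntegrable (fun x : ℝ ↦ g x) MeasureTheory.volume 0 1 := by
    simpa using hcont (y := 0) (by simpa using hb0)
  -- `m` is also the mean at height `y`, and `g` oscillates by at most `K` along a segment of length
  -- one.
  have hosc : ∀ y : ℝ, |y| ≤ d → ∀ x ∈ Set.Icc (0 : ℝ) 1, ‖g (x + y * I) - m‖ ≤ K := by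
    intro y hy x hx
    have hyb : |y| < b := hy.trans_lt hdb
    have hK0 : 0 ≤ K := (norm_nonneg _).trans (hK (y * I) (by simpa using hy))
    have h0 := integral_horizontal_eq hg hper hyb (y' := 0) (by simpa using hb0)
    simp only [ofReal_zero, zero_mul, add_zero, ← hm] at h0
    have h1 : g (x + y * I) - m = ∫ t in (0 : ℝ)..1, (g (x + y * I) - g (t + y * I)) := by
      rw [integral_sub (by simp) (hcont hyb), h0]
      simp
    rw [h1]
    have h2 := norm_integral_le_of_norm_le_const (a := (0 : ℝ)) (b := 1) (C := K)
      (f := fun t : ℝ ↦ g (x + y * I) - g (t + y * I)) (fun t ht ↦ by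
        rw [Set.uIoc_of_le zero_le_one] at ht
        have hline : Convex ℝ {ζ : ℂ | |ζ.im| ≤ d} := by
          have : {ζ : ℂ | |ζ.im| ≤ d} = imLm ⁻¹' Set.Icc (-d) d := by
            ext ζ; simp [abs_le]
          rw [this]
          exact (convex_Icc _ _).linear_preimage _
        have h3 := hline.norm_image_sub_le_of_norm_deriv_le (𝕜 := ℂ) (f := g) (C := K)
          (x := t + y * I) (y := x + y * I)
          (fun ζ (hζ : |ζ.im| ≤ d) ↦
            hg.differentiableAt ((isOpen_strip b).mem_nhds (hζ.trans_lt hdb)))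
          (fun ζ hζ ↦ hK ζ hζ)
          (show |_| ≤ d by simpa using hy) (show |_| ≤ d by simpa using hy)
        have h4 : ‖((x : ℂ) + y * I) - (t + y * I)‖ ≤ 1 := by
          rw [add_sub_add_right_eq_sub, ← ofReal_sub, norm_real, Real.norm_eq_abs, abs_le]
          constructor <;> linarith [hx.1, hx.2, ht.1, ht.2]
        exact h3.trans (mul_le_of_le_one_right hK0 h4))
    simpa using h2
  have hbdd : ∀ ζ : ℂ, |ζ.im| ≤ d → ‖g ζ - m‖ ≤ K := by
    intro ζ hζ
    have hP := periodic_horizontal hper (hζ.trans_lt hdb)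
    obtain ⟨x, hx, hxe⟩ := hP.exists_mem_Ico₀ one_pos ζ.re
    simp only [re_add_im] at hxe
    rw [hxe]
    exact hosc _ hζ x ⟨hx.1, hx.2.le⟩
  have hfin : ∀ ζ : ℂ, |ζ.im| ≤ d - s → ‖g ζ - m‖ ≤
      K * (2 * (Real.exp (-(2 * Real.pi * s)) / (1 - Real.exp (-(2 * Real.pi * s))))) := by
    intro ζ hζ
    refine norm_le_of_integral_eq_zero (g := fun ζ ↦ g ζ - m) (hg.sub_const m)
      (fun ζ hζ ↦ by simp only [hper ζ hζ]) hd hdb hbdd ?_ hs hζ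
    rw [integral_sub hcont0 (by simp), ← hm]
    simp
  have h5 := norm_sub_le (g z - m) (g w - m)
  rw [sub_sub_sub_cancel_right] at h5
  linarith [hfin z hz, hfin w hw]

/-! ### Lifting to the universal cover. -/

theorem cylProj_eq_iff {z w : ℂ} : cylProj z = cylProj w ↔ ∃ n : ℤ, w = z + n := by
  unfold cylProj
  rw [QuotientAddGroup.eq, AddSubgroup.mem_zmultiples_iff]
  refine exists_congr fun n ↦ ?_
  rw [zsmul_one, eq_neg_add_iff_add_eq, eq_comm]

theorem cylProj_add_one (z : ℂ) : cylProj (z + 1) = cylProj z :=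
  (cylProj_eq_iff.2 ⟨1, by simp⟩).symm

theorem dist_cylProj_le (z w : ℂ) : dist (cylProj z) (cylProj w) ≤ ‖z - w‖ := by
  rw [dist_eq_norm]
  exact QuotientAddGroup.norm_mk_le_norm (S := AddSubgroup.zmultiples (1 : ℂ)) (m := z - w)

theorem isCoveringMap_cylProj : IsCoveringMap cylProj :=
  (AddSubgroup.isAddQuotientCoveringMap_of_comm (AddSubgroup.zmultiples (1 : ℂ))
    (SetLike.isDiscrete_iff_discreteTopology.2 inferInstance)).isCoveringMap

theorem cylProj_mem_stripMod {b : ℝ} {z : ℂ} : cylProj z ∈ stripMod b ↔ z ∈ strip b := by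
  refine ⟨?_, fun h ↦ ⟨z, h, rfl⟩⟩
  rintro ⟨w, hw, hwz⟩
  obtain ⟨n, rfl⟩ := cylProj_eq_iff.1 hwz
  simpa [mem_strip] using hw

/-- A continuous function on a connected set that takes integer values differs nowhere from its
value at one point. -/
theorem eq_of_continuousOn_of_forall_exists_int {S : Set ℂ} (hS : IsPreconnected S) {u : ℂ → ℂ}
    (hu : ContinuousOn u S) (hint : ∀ z ∈ S, ∃ n : ℤ, u z = n) {z w : ℂ} (hz : z ∈ S)
    (hw : w ∈ S) : u z = u w := by
  have hd : IsDiscrete (Set.range ((↑) : ℤ → ℂ)) := by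
    have h : Set.range ((↑) : ℤ → ℂ) = (AddSubgroup.zmultiples (1 : ℂ) : Set ℂ) := by
      ext w
      simp [AddSubgroup.mem_zmultiples_iff]
    rw [h]
    exact SetLike.isDiscrete_iff_discreteTopology.2 inferInstance
  exact hS.constant_of_mapsTo hd hu (fun z hz ↦ (hint z hz).imp fun n hn ↦ hn.symm) hz hw

/-- A continuous map on `B(b) / ℤ` with values in `ℂ / ℤ` lifts to the strip. -/
theorem exists_lift_strip {b : ℝ} (hb : 0 < b) (φ : C(stripMod b, Cyl))
    (h₀ : φ (stripModPt hb 0) = cylProj ((0 : ℝ) : ℂ)) :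
    ∃ f : ℂ → ℂ, ContinuousOn f (strip b) ∧ f 0 = 0 ∧
      ∀ z (hz : z ∈ strip b), cylProj (f z) = φ ⟨cylProj z, cylProj_mem_stripMod.2 hz⟩ := by
  have h0 : (0 : ℂ) ∈ strip b := by simpa [mem_strip] using hb
  have : ContractibleSpace (strip b) := (convex_strip b).contractibleSpace ⟨0, h0⟩
  have : LocallyPathConnectedSpace (strip b) := (isOpen_strip b).locallyPathConnectedSpace
  let ψ : C(strip b, Cyl) :=
    φ.comp ⟨fun z ↦ ⟨cylProj z, cylProj_mem_stripMod.2 z.2⟩,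
      (continuous_cylProj.comp continuous_subtype_val).subtype_mk _⟩
  obtain ⟨F, ⟨hF0, hF⟩, -⟩ := isCoveringMap_cylProj.existsUnique_continuousMap_lifts ψ ⟨0, h0⟩ 0
    (by simpa [ψ, stripModPt] using h₀.symm)
  classical
  refine ⟨fun z ↦ if hz : z ∈ strip b then F ⟨z, hz⟩ else 0, ?_, by simp [h0, hF0], ?_⟩
  · rw [continuousOn_iff_continuous_domRestrict]
    convert! F.continuous using 1
    ext z
    simp
  · intro z hz
    simp only [hz, dif_pos]
    exact congrFun hF ⟨z, hz⟩

/-- Homotopic loops have lifts from `0` with the same endpoint; here the lifts are `f` along `[0,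
1]` and the segment itself. -/
theorem lift_one_eq_one {b : ℝ} (hb : 0 < b) {φ : C(stripMod b, Cyl)}
    (h₀ : φ (stripModPt hb 0) = cylProj ((0 : ℝ) : ℂ))
    (h₁ : FundamentalGroup.mapOfEq φ h₀ (stripGen hb) = cylGen) {f : ℂ → ℂ}
    (hf : ContinuousOn f (strip b)) (hf0 : f 0 = 0)
    (hlift : ∀ z (hz : z ∈ strip b), cylProj (f z) = φ ⟨cylProj z, cylProj_mem_stripMod.2 hz⟩) :
    f 1 = 1 := by
  have hmem : ∀ t : ℝ, (t : ℂ) ∈ strip b := fun t ↦ by simpa [mem_strip] using hb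
  rw [FundamentalGroup.mapOfEq_apply] at h₁
  have hhom : (((stripLoop hb).map φ.continuous).cast h₀.symm h₀.symm).Homotopic cylLoop :=
    Path.Homotopic.Quotient.eq.1 h₁
  let Γ₀ : C(unitInterval, ℂ) := ⟨fun t ↦ f ((t : ℝ) : ℂ),
    hf.comp_continuous (by fun_prop) fun t ↦ hmem t⟩
  let Γ₁ : C(unitInterval, ℂ) := ⟨fun t ↦ ((t : ℝ) : ℂ), by fun_prop⟩
  have h := isCoveringMap_cylProj.liftPath_apply_one_eq_of_homotopicRel hhom 0
    (by simp) (by simp)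
  rw [← (isCoveringMap_cylProj.eq_liftPath_iff' _ (Γ := Γ₀)).2 ⟨?_, ?_⟩,
    ← (isCoveringMap_cylProj.eq_liftPath_iff' _ (Γ := Γ₁)).2 ⟨?_, ?_⟩] at h
  · simpa [Γ₀, Γ₁] using h
  · rfl
  · simp [Γ₁]
  · ext t
    exact hlift _ (hmem t)
  · simp [Γ₀, hf0]

/-- The difference `f (z + 1) - f z` is continuous and integer-valued on a connected set, so its
value at `0` decides. -/
theorem lift_add_one {b : ℝ} {φ : stripMod b → Cyl} {f : ℂ → ℂ}
    (hf : ContinuousOn f (strip b))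
    (hlift : ∀ z (hz : z ∈ strip b), cylProj (f z) = φ ⟨cylProj z, cylProj_mem_stripMod.2 hz⟩)
    (hf01 : f 1 = f 0 + 1) {z : ℂ} (hz : z ∈ strip b) : f (z + 1) = f z + 1 := by
  have hb : 0 < b := (abs_nonneg z.im).trans_lt hz
  have h := eq_of_continuousOn_of_forall_exists_int (convex_strip b).isPreconnected
    (u := fun z ↦ f (z + 1) - f z)
    ((hf.comp (by fun_prop) fun z hz ↦ add_one_mem_strip.2 hz).sub hf) (fun z hz ↦ by
      have hz1 := add_one_mem_strip.2 hz
      have : cylProj (f z) = cylProj (f (z + 1)) := by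
        rw [hlift z hz, hlift _ hz1]
        congr 2
        exact (cylProj_add_one z).symm
      obtain ⟨n, hn⟩ := cylProj_eq_iff.1 this
      exact ⟨n, by simp [hn]⟩) hz (show (0 : ℂ) ∈ strip b by simpa [mem_strip] using hb)
  simp only [zero_add, hf01] at h
  linear_combination h

/-- Near each point, `f` differs from a local holomorphic representative of `φ` by a constant
integer. -/
theorem differentiableOn_lift {b : ℝ} {φ : stripMod b → Cyl} (hφ : IsHolomorphicOnCyl φ)
    {f : ℂ → ℂ} (hf : ContinuousOn f (strip b))
    (hlift : ∀ z (hz : z ∈ strip b), cylProj (f z) = φ ⟨cylProj z, cylProj_mem_stripMod.2 hz⟩) :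
    DifferentiableOn ℂ f (strip b) := by
  intro z₀ hz₀
  obtain ⟨g, hg, hgφ⟩ := hφ z₀ (cylProj_mem_stripMod.2 hz₀)
  obtain ⟨r, hr, hball⟩ := Metric.eventually_nhds_iff_ball.1
    ((hgφ.and hg.eventually_continuousAt).and ((isOpen_strip b).eventually_mem hz₀))
  have hsub : Metric.ball z₀ r ⊆ strip b := fun z hz ↦ (hball z hz).2
  have hconst : ∀ z ∈ Metric.ball z₀ r, f z = g z + (f z₀ - g z₀) := by
    intro z hz
    have := eq_of_continuousOn_of_forall_exists_int (convex_ball z₀ r).isPreconnected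
      (u := fun z ↦ f z - g z)
      ((hf.mono hsub).sub fun z hz ↦ (hball z hz).1.2.continuousWithinAt) (fun z hz ↦ by
        have hzs := hsub hz
        have h := (hball z hz).1.1 (cylProj_mem_stripMod.2 hzs)
        rw [← hlift z hzs] at h
        obtain ⟨n, hn⟩ := cylProj_eq_iff.1 h.symm
        exact ⟨n, by simp [hn]⟩) hz (Metric.mem_ball_self hr)
    linear_combination this
  refine DifferentiableAt.differentiableWithinAt ?_
  refine (hg.differentiableAt.add_const (f z₀ - g z₀)).congr_of_eventuallyEq ?_
  filter_upwards [Metric.ball_mem_nhds z₀ hr] with z hz using hconst z hz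

theorem norm_deriv_lift_le {b : ℝ} {φ : stripMod b → Cyl} (hφ : Function.Injective φ)
    {f : ℂ → ℂ} (hf : DifferentiableOn ℂ f (strip b))
    (hlift : ∀ z (hz : z ∈ strip b), cylProj (f z) = φ ⟨cylProj z, cylProj_mem_stripMod.2 hz⟩)
    {z₀ : ℂ} (hz₀ : |z₀.im| ≤ b - 1) : ‖deriv f z₀‖ ≤ 192 := by
  -- Radius `1/4` keeps two points of the disc less than `1` apart, so those with equal projections
  -- coincide; the bound is `192 = 4 * 48`.
  have hsub : Metric.closedBall z₀ (1 / 4) ⊆ strip b := by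
    intro z hz
    rw [Metric.mem_closedBall, dist_eq_norm] at hz
    have h1 := (Complex.abs_im_le_norm (z - z₀)).trans hz
    rw [Complex.sub_im] at h1
    have h2 := abs_sub_abs_le_abs_sub z.im z₀.im
    rw [mem_strip]
    linarith
  have := mul_norm_deriv_le_of_forall_ne_add_one (isOpen_strip b) hf
    (by norm_num : (0 : ℝ) < 1 / 4) hsub (fun z hz w hw heq ↦ by
      have h1 : cylProj (f z) = cylProj (f w) := by rw [heq, cylProj_add_one]
      rw [hlift z (hsub hz), hlift w (hsub hw)] at h1
      obtain ⟨n, hn⟩ := cylProj_eq_iff.1 (Subtype.ext_iff.1 (hφ h1))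
      have h2 : dist w z ≤ 1 / 4 + 1 / 4 :=
        (dist_triangle_right w z z₀).trans (add_le_add hw hz)
      have h3 : |(n : ℝ)| < 1 := by
        rw [hn, dist_eq_norm, add_sub_cancel_left, Complex.norm_intCast] at h2
        linarith
      have h4 : n = 0 := by
        rw [← Int.abs_lt_one_iff]
        exact_mod_cast h3
      rw [h4, Int.cast_zero, add_zero] at hn
      rw [hn] at heq
      simp at heq)
  linarith

/-! ### Choice of the constant and conclusion. -/

theorem exists_pos_exp_small {δ : ℝ} (hδ : 0 < δ) :
    ∃ s : ℝ, 0 < s ∧ Real.exp (-(2 * Real.pi * s)) / (1 - Real.exp (-(2 * Real.pi * s))) < δ := by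
  have h1 : Filter.Tendsto (fun s : ℝ ↦ Real.exp (-(2 * Real.pi * s))) Filter.atTop (𝓝 0) :=
    Real.tendsto_exp_neg_atTop_nhds_zero.comp
      (Filter.tendsto_id.const_mul_atTop (by positivity))
  have h2 := h1.div (h1.const_sub 1) (by norm_num)
  rw [zero_div] at h2
  obtain ⟨s, hs, hs'⟩ := ((Filter.eventually_gt_atTop 0).and (h2.eventually_lt_const hδ)).exists
  exact ⟨s, hs, hs'⟩

theorem theorem6p1 (ε : ℝ) (hε : 0 < ε) :
    ∃ c : ℝ, 0 < c ∧ ∀ (b : ℝ) (hb : 0 < b), c < b →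
      ∀ (φ : C(stripMod b, Cyl)), IsConformalEmbedding φ →
        ∀ (h₀ : φ (stripModPt hb 0) = cylProj ((0 : ℝ) : ℂ)),
          FundamentalGroup.mapOfEq φ h₀ (stripGen hb) = cylGen →
            ∀ q : stripMod b, (q : Cyl) ∈ stripMod (b - c) → dist (φ q) (q : Cyl) < ε := by
  obtain ⟨s, hs, hsε⟩ := exists_pos_exp_small (δ := ε / (4 * 193)) (by positivity)
  -- Depth `1` is spent on the derivative bound and depth `s` on the exponential decay.
  refine ⟨s + 1, by positivity, ?_⟩
  intro b hb hcb φ hφ h₀ h₁ q hq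
  obtain ⟨f, hfc, hf0, hlift⟩ := exists_lift_strip hb φ h₀
  have hf1 := lift_one_eq_one hb h₀ h₁ hfc hf0 hlift
  have hfd := differentiableOn_lift hφ.holomorphic hfc hlift
  obtain ⟨q, hqb⟩ := q
  obtain ⟨z, hz, rfl⟩ := hq
  have hzb : z ∈ strip b := cylProj_mem_stripMod.1 hqb
  rw [← hlift z hzb]
  refine (dist_cylProj_le _ _).trans_lt ?_
  -- `193 = 192 + 1` bounds the derivative of `f z - z`; the comparison point `0` is where this
  -- function vanishes.
  have hkey := norm_sub_le_of_norm_deriv_le (g := fun z ↦ f z - z) (b := b) (d := b - 1) (K := 193)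
    (hfd.sub differentiableOn_id)
    (fun w hw ↦ by
      simp only [lift_add_one hfc hlift (by rw [hf1, hf0, zero_add]) hw]
      ring)
    (by linarith) (by linarith)
    (fun w hw ↦ by
      have hwb : w ∈ strip b := by rw [mem_strip]; linarith
      have h := ((hfd.differentiableAt ((isOpen_strip b).mem_nhds hwb)).hasDerivAt.sub
        (hasDerivAt_id w)).deriv
      have h2 : deriv (fun z ↦ f z - z) w = deriv f w - 1 := h
      rw [h2]
      have h3 := norm_deriv_lift_le hφ.injective hfd hlift hw
      have h4 := norm_sub_le (deriv f w) 1
      rw [norm_one] at h4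
      linarith)
    hs (z := z) (w := 0) (by rw [mem_strip] at hz; linarith) (by simp; linarith)
  rw [hf0, sub_zero, sub_zero] at hkey
  refine hkey.trans_lt ?_
  rw [lt_div_iff₀ (by norm_num)] at hsε
  linarith
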